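/- Let $\mathbb K$ be an uncountable field and let $n\ge 2$, $k\ge 3$ be integers with $(n,k)\neq(2,3)$. Let $\mathcal P_{n,k}$ be the (finite-dimensional) $\mathbb K$-vector space of all elements $F$ of the free algebra $\mathbb K\langle x_1,\dots,x_n\rangle$ that are homogeneous of degree $k$ and cyclically invariant, i.e. fixed by the linear map sending each word $x_ju$ to $ux_j$. For $F\in\mathcal P_{n,k}$ let $A_F=\mathbb K\langle x_1,\dots,x_n\rangle/(\delta_{x_1}F,\dots,\delta_{x_n}F)$ be the quotient by the two-sided ideal generated by the $\delta_{x_j}F$, where $\delta_{x_j}$ is the linear map sending a word $x_ju$ to $u$ and every word not starting with $x_j$ to $0$. Then for generic $F\in\mathcal P_{n,k}$ one has $x_1a\neq 0$ in $A_F$ for every non-zero $a\in A_F$. Here "for generic $F$" means: for all $F\in\mathcal P_{n,k}$ outside the union of some countable family of proper Zariski closed subsets of $\mathcal P_{n,k}$. -/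

import Mathlib

/-- The free associative algebra `K⟨x_1, …, x_n⟩`: finite linear combinations of words in `n` letters
(letters are indexed by `Fin n`, so `x_1` is the letter `0`). The coefficient of the
word `w` in `F` is `F.coeff w`. -/
abbrev FreeAlg (K : Type*) [Field K] (n : ℕ) : Type _ :=
  MonoidAlgebra K (FreeMonoid (Fin n))

/-- The generator `x_j` of the free algebra. -/
noncomputable def gen (K : Type*) [Field K] {n : ℕ} (j : Fin n) : FreeAlg K n :=
  MonoidAlgebra.single (FreeMonoid.of j) 1

/-- `K^cyc⟨x_1, …, x_n⟩`: the elements fixed by the linear map sending each word `x_j u` to `u x_j`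
(and `1` to `1`), that is, the words `x_j u` and `u x_j` always have the same coefficient. -/
def cyclicInvariants (K : Type*) [Field K] (n : ℕ) : Submodule K (FreeAlg K n) where
  carrier := {F | ∀ (j : Fin n) (u : FreeMonoid (Fin n)),
    F.coeff (FreeMonoid.of j * u) = F.coeff (u * FreeMonoid.of j)}
  add_mem' := by
    intro F G hF hG j u
    simp [hF j u, hG j u]
  zero_mem' := by
    intro j u
    simp
  smul_mem' := by
    intro c F hF j u
    simp [hF j u]

/-- The homogeneous elements of degree `k` of the free algebra: combinations of words of
length `k`. -/
def homogeneousPart (K : Type*) [Field K] (n k : ℕ) : Submodule K (FreeAlg K n) where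
  carrier := {F | ∀ w : FreeMonoid (Fin n), w.length ≠ k → F.coeff w = 0}
  add_mem' := by
    intro F G hF hG w hw
    simp [hF w hw, hG w hw]
  zero_mem' := by
    intro w _
    simp
  smul_mem' := by
    intro c F hF w hw
    simp [hF w hw]

/-- The space `𝓟_{n,k}` of homogeneous potentials of degree `k` in `n` variables. -/
noncomputable def potentials (K : Type*) [Field K] (n k : ℕ) : Submodule K (FreeAlg K n) :=
  cyclicInvariants K n ⊓ homogeneousPart K n k

/-- The noncommutative derivative `δ_{x_j}`: the linear map sending a word `x_j u` to `u` and every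
word that does not start with `x_j` to `0`. Thus the coefficient of `u` in `δ_{x_j} F` is
the coefficient of `x_j u` in `F`. -/
noncomputable def ncDeriv {K : Type*} [Field K] {n : ℕ} (j : Fin n) (F : FreeAlg K n) :
    FreeAlg K n :=
  MonoidAlgebra.ofCoeff
    (F.coeff.comapDomain (fun u => FreeMonoid.of j * u) (mul_right_injective _).injOn)

/-- The two-sided ideal of relations, generated by `δ_{x_1} F, …, δ_{x_n} F`. -/
noncomputable def relationIdeal {K : Type*} [Field K] {n : ℕ} (F : FreeAlg K n) :
    TwoSidedIdeal (FreeAlg K n) :=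
  TwoSidedIdeal.span (Set.range fun j : Fin n => ncDeriv j F)

/-- The potential algebra `A_F = K⟨x_1, …, x_n⟩ / (δ_{x_1} F, …, δ_{x_n} F)`. -/
abbrev PotentialAlgebra {K : Type*} [Field K] {n : ℕ} (F : FreeAlg K n) : Type _ :=
  (relationIdeal F).ringCon.Quotient

/-- The class of `x_j` in the potential algebra `A_F`. -/
noncomputable def PotentialAlgebra.gen {K : Type*} [Field K] {n : ℕ} (F : FreeAlg K n)
    (j : Fin n) : PotentialAlgebra F :=
  (relationIdeal F).ringCon.mk' (_root_.gen K j)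

/-- Zariski closed subsets of a vector space `V` (used for finite-dimensional `V`): the common zero
sets of families of polynomial functions, a polynomial function being a polynomial expression in
linear functionals on `V`. -/
def IsZariskiClosed (K : Type*) [Field K] {V : Type*} [AddCommGroup V] [Module K V]
    (Z : Set V) : Prop :=
  ∃ S : Set (MvPolynomial (Module.Dual K V) K),
    Z = {v : V | ∀ p ∈ S, MvPolynomial.eval (fun φ : Module.Dual K V => φ v) p = 0}

/-- A property holds for generic `v ∈ V` if it holds outside the union of countably many proper
Zariski closed subsets of `V` (the usual meaning over an uncountable field). -/
def HoldsGenerically (K : Type*) [Field K] {V : Type*} [AddCommGroup V] [Module K V]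
    (P : V → Prop) : Prop :=
  ∃ Z : ℕ → Set V, (∀ i, IsZariskiClosed K (Z i) ∧ Z i ≠ Set.univ) ∧
    ∀ v : V, (∀ i, v ∉ Z i) → P v

/-!
Fix for each `j` a word `L j` such that the `L j` are distinct, have length `k - 1`, do not start
with `x_1`, and overlap in only one way (`SingleOverlap`). Call a word normal if it contains no
`L j`. The claim follows once, for generic `F`, the normal words form a basis of `A_F`, because
prepending `x_1` maps normal words injectively to normal words.

To each non-normal word `w = p (L j) u`, with the last occurrence of a leading word displayed,
attach the relation `p (δ_j F) u`, which is linear in `F`. Replacing each non-normal word by its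
relation gives a family `mixedFamily L F` indexed by all words. In each degree its coefficient matrix is
square, with entries that are constants or linear functionals of `F`, so the vanishing of its
determinant is a Zariski closed condition on `F`. These countably many conditions, one for each
degree, cut out the exceptional set.

If no determinant vanishes, then the free algebra is the direct sum of the span of the normal words
and the span `S` of the attached relations, and `S` is all of the relation ideal
(`mem_relationIdeal_iff`). Indeed `S` is a left ideal, so it only has to contain the products
`(δ_j F) u` with `u` normal. Each of these is an attached relation, except when the single overlap
intervenes, that is for `(δ_1 F) x_1 u'`; such a product is rewritten by means of the identity
`∑ x_j (δ_j F) = ∑ (δ_j F) x_j`, which holds because `F` is cyclically invariant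
(`sum_gen_mul_ncDeriv`). So the one overlap of the leading words is resolved by the one syzygy that
every potential has.

The conditions are proper because there is a potential, `examplePotential`, in which `L j` is the
lexicographically largest word of `δ_j F`: its matrices are triangular with ones on the diagonal. It
is the sum of all rearrangements of `x y z ^ (k - 2)` and of the `x w ^ (k - 1)`, with `x` the
largest letter, `y` the next one, `z = x_1` the smallest and `w` running over the other letters. For
two letters one takes `y = x`, and then `k ≥ 4` is needed to avoid further overlaps.
-/

/-! ### Words, coefficients and the syzygy of a potential -/

section Words

variable {K : Type*} [Field K] {n : ℕ}

/-- The monomial of the free algebra given by a list of letters. -/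
noncomputable def word (K : Type*) [Field K] {n : ℕ} (l : List (Fin n)) : FreeAlg K n :=
  MonoidAlgebra.single (FreeMonoid.ofList l) 1

/-- The coefficient of an element of the free algebra at a list of letters. -/
noncomputable def coeffAt (l : List (Fin n)) : FreeAlg K n →ₗ[K] K where
  toFun F := F.coeff (FreeMonoid.ofList l)
  map_add' _ _ := rfl
  map_smul' _ _ := rfl

theorem ext_coeffAt {F G : FreeAlg K n} (h : ∀ l, coeffAt l F = coeffAt l G) : F = G := by
  apply MonoidAlgebra.coeff_injective
  ext l
  exact h l.toList

theorem coeffAt_word (l l' : List (Fin n)) :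
    coeffAt l' (word K l) = if l = l' then 1 else 0 :=
  Finsupp.single_apply (α := List (Fin n)) (a := l) (a' := l')

theorem word_cons (i : Fin n) (l : List (Fin n)) : word K (i :: l) = gen K i * word K l := by
  simp [word, gen, MonoidAlgebra.single_mul_single]

theorem word_nil : word K ([] : List (Fin n)) = 1 := rfl

theorem span_word : Submodule.span K (Set.range (word K (n := n))) = ⊤ := by
  rw [eq_top_iff]
  rintro F -
  induction F using MonoidAlgebra.induction_linear with
  | zero => exact zero_mem _
  | add f g hf hg => exact add_mem hf hg
  | single m r =>
    have : MonoidAlgebra.single m r = r • word K m.toList := by simp [word]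
    rw [this]
    exact Submodule.smul_mem _ _ (Submodule.subset_span ⟨_, rfl⟩)

theorem coeffAt_gen_mul_nil (j : Fin n) (F : FreeAlg K n) : coeffAt [] (gen K j * F) = 0 :=
  MonoidAlgebra.coeff_single_mul_of_forall_mul_ne _ _ fun _ h =>
    List.cons_ne_nil _ _ (congrArg FreeMonoid.toList h)

theorem coeffAt_gen_mul_cons (j i : Fin n) (l : List (Fin n)) (F : FreeAlg K n) :
    coeffAt (i :: l) (gen K j * F) = if j = i then coeffAt l F else 0 := by
  split_ifs with h
  · subst h
    exact (MonoidAlgebra.coeff_single_mul_mul F 1 (FreeMonoid.of j) (FreeMonoid.ofList l)).trans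
      (one_mul _)
  · refine MonoidAlgebra.coeff_single_mul_of_forall_mul_ne _ _ fun d hd => h ?_
    have := congrArg FreeMonoid.toList hd
    simp only [FreeMonoid.toList_mul, FreeMonoid.toList_of, FreeMonoid.toList_ofList] at this
    exact (List.cons.inj this).1

theorem coeffAt_append_mul_word (t u : List (Fin n)) (F : FreeAlg K n) :
    coeffAt (t ++ u) (F * word K u) = coeffAt t F :=
  (MonoidAlgebra.coeff_mul_single_mul F 1 (FreeMonoid.ofList u) (FreeMonoid.ofList t)).trans
    (mul_one _)

theorem coeffAt_mul_word_eq_zero {l u : List (Fin n)} (h : ∀ t, t ++ u ≠ l) (F : FreeAlg K n) :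
    coeffAt l (F * word K u) = 0 :=
  MonoidAlgebra.coeff_mul_single_of_forall_mul_ne _ _ fun d hd =>
    h d.toList (congrArg FreeMonoid.toList hd)

theorem coeffAt_ncDeriv (j : Fin n) (u : List (Fin n)) (F : FreeAlg K n) :
    coeffAt u (ncDeriv j F) = coeffAt (j :: u) F := rfl

/-- The noncommutative derivative as a linear map. -/
noncomputable def ncDerivLinear (j : Fin n) : FreeAlg K n →ₗ[K] FreeAlg K n where
  toFun := ncDeriv j
  map_add' F G := ext_coeffAt fun l => by simp [coeffAt_ncDeriv]
  map_smul' c F := ext_coeffAt fun l => by simp [coeffAt_ncDeriv]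

theorem gen_mul_injective (j : Fin n) : Function.Injective (gen K j * · : FreeAlg K n → _) := by
  intro F G h
  refine ext_coeffAt fun l => ?_
  simpa [coeffAt_gen_mul_cons] using congrArg (coeffAt (j :: l)) h

/-- Both sums are `F` minus its constant term. -/
theorem sum_gen_mul_ncDeriv {F : FreeAlg K n} (hF : F ∈ cyclicInvariants K n) :
    ∑ j, gen K j * ncDeriv j F = ∑ j, ncDeriv j F * gen K j := by
  refine ext_coeffAt fun l => ?_
  simp only [map_sum]
  rcases l.eq_nil_or_concat with rfl | ⟨t, i, rfl⟩
  · rw [Finset.sum_eq_zero fun j _ => coeffAt_gen_mul_nil j _,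
      Finset.sum_eq_zero fun j _ => ?_]
    exact coeffAt_mul_word_eq_zero (by simp) _
  · have hr : ∑ j, coeffAt (t ++ [i]) (ncDeriv j F * gen K j) = coeffAt (i :: t) F := by
      rw [Finset.sum_eq_single i]
      · exact coeffAt_append_mul_word t [i] _
      · intro j _ hj
        refine coeffAt_mul_word_eq_zero (fun s hs => hj ?_) _
        simpa using (List.append_inj' hs rfl).2
      · simp
    have hl : ∀ l : List (Fin n), l ≠ [] →
        ∑ j, coeffAt l (gen K j * ncDeriv j F) = coeffAt l F := by
      rintro (_ | ⟨a, s⟩) h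
      · exact absurd rfl h
      · rw [Finset.sum_eq_single a]
        · rw [coeffAt_gen_mul_cons, if_pos rfl, coeffAt_ncDeriv]
        · intro j _ hj
          rw [coeffAt_gen_mul_cons, if_neg hj]
        · simp
    rw [List.concat_eq_append, hr, hl _ (by simp)]
    exact (hF i (FreeMonoid.ofList t)).symm

end Words

/-! ### Normal words and the relation ideal -/

section Reduction

variable {K : Type*} [Field K] {n : ℕ}

/-- A word is normal with respect to the family `L` if no `L j` occurs in it as a block of
consecutive letters. -/
def IsNormalWord (L : Fin n → List (Fin n)) (u : List (Fin n)) : Prop :=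
  ∀ j, ¬ L j <:+: u

/-- Combinatorial conditions on a family `L` of would-be leading words of the derivatives of a
potential: they are distinct, non-empty and of equal length, none of them starts with the letter
`z`, and a normal word `u` can complete the tail of some `L j` to a non-normal word only for `j = z`
and `u` starting with `z`. In particular two of these words overlap only in words of the form
`L z ++ z :: v`. -/
structure SingleOverlap (L : Fin n → List (Fin n)) (z : Fin n) : Prop where
  ne_nil : ∀ j, L j ≠ []
  length_eq : ∀ i j, (L i).length = (L j).length
  injective : Function.Injective L
  ne_cons : ∀ j u, L j ≠ z :: u
  overlap : ∀ j u, IsNormalWord L u → ¬ IsNormalWord L ((L j).tail ++ u) → j = z ∧ ∃ u', u = z :: u'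

variable {L : Fin n → List (Fin n)} {z : Fin n}

theorem IsNormalWord.of_cons {i : Fin n} {u : List (Fin n)} (h : IsNormalWord L (i :: u)) :
    IsNormalWord L u :=
  fun j hj => h j (hj.trans (List.suffix_cons i u).isInfix)

theorem IsNormalWord.cons (hL : SingleOverlap L z) {u : List (Fin n)} (h : IsNormalWord L u) :
    IsNormalWord L (z :: u) := by
  intro j hj
  rcases List.infix_cons_iff.1 hj with ⟨t, ht⟩ | hj
  · rcases hLj : L j with _ | ⟨a, s⟩
    · exact hL.ne_nil j hLj
    · rw [hLj] at ht
      obtain ⟨rfl, -⟩ := List.cons.inj ht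
      exact hL.ne_cons j s hLj
  · exact h j hj

theorem not_isNormalWord_append (j : Fin n) (u : List (Fin n)) :
    ¬ IsNormalWord L (L j ++ u) :=
  fun h => h j ⟨[], u, by simp⟩

theorem SingleOverlap.normal_tail (hL : SingleOverlap L z) {j : Fin n} {u : List (Fin n)}
    (hu : IsNormalWord L u) (hj : j ≠ z ∨ ∀ u', u ≠ z :: u') : IsNormalWord L (L j ++ u).tail := by
  rw [List.tail_append_of_ne_nil (hL.ne_nil j)]
  by_contra h
  obtain ⟨rfl, u', rfl⟩ := hL.overlap j u hu h
  rcases hj with hj | hj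
  · exact hj rfl
  · exact hj u' rfl

/-- Induction on non-normal words, along the position of the last occurrence of a leading word. -/
theorem SingleOverlap.not_normal_induction (hL : SingleOverlap L z) {P : List (Fin n) → Prop}
    (base : ∀ j u, IsNormalWord L (L j ++ u).tail → P (L j ++ u))
    (step : ∀ i v, ¬ IsNormalWord L v → P v → P (i :: v)) :
    ∀ w, ¬ IsNormalWord L w → P w := by
  intro w
  induction w with
  | nil =>
    intro h
    exact (h fun j hj => hL.ne_nil j (List.infix_nil.1 hj)).elim
  | cons i v ih =>
    intro h
    by_cases hv : IsNormalWord L v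
    · simp only [IsNormalWord, not_forall, not_not] at h
      obtain ⟨j, hj⟩ := h
      rcases List.infix_cons_iff.1 hj with ⟨u, hu⟩ | hj
      · rw [← hu]
        refine base j u ?_
        rw [hu]
        exact hv
      · exact absurd hj (hv j)
    · exact step i v hv (ih hv)

open Classical in
/-- The relation `p * δ_j F * u` attached to a non-normal word `w = p ++ L j ++ u`, where the
occurrence of `L j` is the last occurrence of a leading word in `w`. It is linear in `F`; its
value on a normal word is irrelevant. -/
noncomputable def relationAt (K : Type*) [Field K] (L : Fin n → List (Fin n)) :
    List (Fin n) → (FreeAlg K n →ₗ[K] FreeAlg K n)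
  | [] => 0
  | i :: v =>
    if IsNormalWord L v then
      if h : ∃ j u, L j ++ u = i :: v then
        (LinearMap.mulRight K (word K h.choose_spec.choose)).comp (ncDerivLinear h.choose)
      else 0
    else (LinearMap.mulLeft K (gen K i)).comp (relationAt K L v)

theorem relationAt_cons (i : Fin n) {v : List (Fin n)} (hv : ¬ IsNormalWord L v) (F : FreeAlg K n) :
    relationAt K L (i :: v) F = gen K i * relationAt K L v F := by
  simp [relationAt, hv]

theorem relationAt_append (hL : SingleOverlap L z) (j : Fin n) (u : List (Fin n))
    (h : IsNormalWord L (L j ++ u).tail) (F : FreeAlg K n) :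
    relationAt K L (L j ++ u) F = ncDeriv j F * word K u := by
  obtain ⟨i, v, hw⟩ : ∃ i v, L j ++ u = i :: v :=
    List.exists_cons_of_ne_nil (by simp [hL.ne_nil j])
  have hex : ∃ j u, L j ++ u = i :: v := ⟨j, u, hw⟩
  obtain ⟨h₁, h₂⟩ := List.append_inj (hex.choose_spec.choose_spec.trans hw.symm)
    (hL.length_eq _ _)
  rw [hw] at h ⊢
  rw [List.tail_cons] at h
  rw [relationAt, if_pos h, dif_pos hex]
  change ncDeriv hex.choose F * word K hex.choose_spec.choose = _
  rw [h₂, hL.injective h₁]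

open Classical in
/-- The family which is the basis of words, with each non-normal word replaced by the relation
attached to it. -/
noncomputable def mixedFamily (L : Fin n → List (Fin n)) (F : FreeAlg K n) (w : List (Fin n)) :
    FreeAlg K n :=
  if IsNormalWord L w then word K w else relationAt K L w F

/-- The span of the normal words. -/
noncomputable def normalSpan (K : Type*) [Field K] (L : Fin n → List (Fin n)) :
    Submodule K (FreeAlg K n) :=
  Submodule.span K (word K '' {w | IsNormalWord L w})

/-- The span of the relations attached to the non-normal words. -/
noncomputable def relationSpan (L : Fin n → List (Fin n)) (F : FreeAlg K n) :
    Submodule K (FreeAlg K n) :=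
  Submodule.span K ((relationAt K L · F) '' {w | ¬ IsNormalWord L w})

theorem mixedFamily_image_normal (F : FreeAlg K n) :
    mixedFamily L F '' {w | IsNormalWord L w} = word K '' {w | IsNormalWord L w} :=
  Set.image_congr fun _ hw => if_pos hw

theorem mixedFamily_image_not_normal (F : FreeAlg K n) :
    mixedFamily L F '' {w | ¬ IsNormalWord L w} =
      (relationAt K L · F) '' {w | ¬ IsNormalWord L w} :=
  Set.image_congr fun _ hw => if_neg hw

theorem disjoint_normalSpan_relationSpan {F : FreeAlg K n}
    (h : LinearIndependent K (mixedFamily L F)) :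
    Disjoint (normalSpan K L) (relationSpan L F) := by
  rw [normalSpan, relationSpan, ← mixedFamily_image_normal F, ← mixedFamily_image_not_normal F]
  refine h.disjoint_span_image ?_
  rw [Set.disjoint_left]
  exact fun w hw hw' => hw' hw

theorem normalSpan_sup_relationSpan {F : FreeAlg K n}
    (h : Submodule.span K (Set.range (mixedFamily L F)) = ⊤) :
    normalSpan K L ⊔ relationSpan L F = ⊤ := by
  rw [normalSpan, relationSpan, ← mixedFamily_image_normal F, ← mixedFamily_image_not_normal F,
    ← Submodule.span_union, ← Set.image_union, ← h, ← Set.image_univ]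
  congr 2
  ext w
  simp [em]

theorem gen_mul_mem_normalSpan (hL : SingleOverlap L z) {a : FreeAlg K n}
    (ha : a ∈ normalSpan K L) : gen K z * a ∈ normalSpan K L := by
  induction ha using Submodule.span_induction with
  | mem x hx =>
    obtain ⟨w, hw, rfl⟩ := hx
    exact Submodule.subset_span ⟨z :: w, IsNormalWord.cons hL hw, word_cons z w⟩
  | zero => simp
  | add x y _ _ hx hy => rw [mul_add]; exact add_mem hx hy
  | smul c x _ hx => rw [mul_smul_comm]; exact Submodule.smul_mem _ c hx

theorem gen_mul_mem_relationSpan (i : Fin n) {F a : FreeAlg K n} (ha : a ∈ relationSpan L F) :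
    gen K i * a ∈ relationSpan L F := by
  induction ha using Submodule.span_induction with
  | mem x hx =>
    obtain ⟨w, hw, rfl⟩ := hx
    exact Submodule.subset_span
      ⟨i :: w, fun h => hw h.of_cons, relationAt_cons i hw F⟩
  | zero => simp
  | add x y _ _ hx hy => rw [mul_add]; exact add_mem hx hy
  | smul c x _ hx => rw [mul_smul_comm]; exact Submodule.smul_mem _ c hx

/-- The relation span is a left ideal. -/
theorem mul_mem_relationSpan (b : FreeAlg K n) {F a : FreeAlg K n} (ha : a ∈ relationSpan L F) :
    b * a ∈ relationSpan L F := by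
  have hb : b ∈ Submodule.span K (Set.range (word K (n := n))) := by
    rw [span_word]
    exact Submodule.mem_top
  induction hb using Submodule.span_induction with
  | mem x hx =>
    obtain ⟨w, rfl⟩ := hx
    induction w with
    | nil => simpa [word_nil] using ha
    | cons i v ih =>
      rw [word_cons, mul_assoc]
      exact gen_mul_mem_relationSpan i ih
  | zero => simp
  | add x y _ _ hx hy => rw [add_mul]; exact add_mem hx hy
  | smul c x _ hx => rw [smul_mul_assoc]; exact Submodule.smul_mem _ c hx

/-- When the normal words and the relations attached to non-normal words span, it suffices to
test `δ_j F * a` on normal words `a`. -/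
theorem ncDeriv_mul_mem_of_normal {F : FreeAlg K n}
    (hF : normalSpan K L ⊔ relationSpan L F = ⊤) {j : Fin n}
    (h : ∀ u, IsNormalWord L u → ncDeriv j F * word K u ∈ relationSpan L F) (a : FreeAlg K n) :
    ncDeriv j F * a ∈ relationSpan L F := by
  obtain ⟨b, hb, c, hc, rfl⟩ := Submodule.mem_sup.1 (hF ▸ Submodule.mem_top : a ∈ _)
  rw [mul_add]
  refine add_mem ?_ (mul_mem_relationSpan _ hc)
  induction hb using Submodule.span_induction with
  | mem x hx =>
    obtain ⟨w, hw, rfl⟩ := hx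
    exact h w hw
  | zero => simp
  | add x y _ _ hx hy => rw [mul_add]; exact add_mem hx hy
  | smul c x _ hx => rw [mul_smul_comm]; exact Submodule.smul_mem _ c hx

theorem ncDeriv_mul_word_mem (hL : SingleOverlap L z) (F : FreeAlg K n) {j : Fin n}
    {u : List (Fin n)} (hu : IsNormalWord L u) (hj : j ≠ z ∨ ∀ u', u ≠ z :: u') :
    ncDeriv j F * word K u ∈ relationSpan L F :=
  Submodule.subset_span ⟨L j ++ u, not_isNormalWord_append j u,
    relationAt_append hL j u (hL.normal_tail hu hj) F⟩

/-- The products missing from the spanning family, `δ_z F * z u'`, are recovered from the syzygy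
`∑ x_j δ_j F = ∑ δ_j F x_j`. -/
theorem ncDeriv_mul_mem (hL : SingleOverlap L z) {F : FreeAlg K n}
    (hcyc : F ∈ cyclicInvariants K n) (hF : normalSpan K L ⊔ relationSpan L F = ⊤)
    (j : Fin n) (a : FreeAlg K n) : ncDeriv j F * a ∈ relationSpan L F := by
  have hne : ∀ i, i ≠ z → ∀ a, ncDeriv i F * a ∈ relationSpan L F := fun i hi =>
    ncDeriv_mul_mem_of_normal hF fun u hu => ncDeriv_mul_word_mem hL F hu (.inl hi)
  by_cases hj : j = z
  · subst hj
    refine ncDeriv_mul_mem_of_normal hF (fun u => ?_) a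
    induction u with
    | nil => exact fun hu => ncDeriv_mul_word_mem hL F hu (.inr fun u' => by simp)
    | cons i v ih =>
      intro hu
      by_cases hi : i = j
      · subst hi
        have hsyz := sum_gen_mul_ncDeriv hcyc
        rw [← Finset.add_sum_erase _ (fun k => ncDeriv k F * gen K k) (Finset.mem_univ i)] at hsyz
        rw [word_cons, ← mul_assoc, ← sub_eq_of_eq_add hsyz, sub_mul, Finset.sum_mul,
          Finset.sum_mul]
        refine sub_mem (sum_mem fun k _ => ?_) (sum_mem fun k hk => ?_)
        · rw [mul_assoc]
          refine gen_mul_mem_relationSpan k ?_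
          by_cases hk : k = i
          · rw [hk]
            exact ih hu.of_cons
          · exact hne k hk _
        · rw [mul_assoc]
          exact hne k (Finset.ne_of_mem_erase hk) _
      · exact ncDeriv_mul_word_mem hL F hu (.inr fun u' h => hi (List.cons.inj h).1)
  · exact hne j hj a

theorem relationSpan_mul_mem (hL : SingleOverlap L z) {F : FreeAlg K n}
    (hcyc : F ∈ cyclicInvariants K n) (hF : normalSpan K L ⊔ relationSpan L F = ⊤)
    {a : FreeAlg K n} (ha : a ∈ relationSpan L F) (b : FreeAlg K n) :
    a * b ∈ relationSpan L F := by
  induction ha using Submodule.span_induction with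
  | mem x hx =>
    obtain ⟨w, hw, rfl⟩ := hx
    refine hL.not_normal_induction (P := fun w => relationAt K L w F * b ∈ relationSpan L F)
      (fun j u h => ?_) (fun i v hv ih => ?_) w hw
    · simp only [relationAt_append hL j u h, mul_assoc]
      exact ncDeriv_mul_mem hL hcyc hF j _
    · simp only [relationAt_cons i hv, mul_assoc]
      exact gen_mul_mem_relationSpan i ih
  | zero => simp
  | add x y _ _ hx hy => rw [add_mul]; exact add_mem hx hy
  | smul c x _ hx => rw [smul_mul_assoc]; exact Submodule.smul_mem _ c hx

theorem relationSpan_subset_relationIdeal (hL : SingleOverlap L z) {F a : FreeAlg K n}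
    (ha : a ∈ relationSpan L F) : a ∈ relationIdeal F := by
  induction ha using Submodule.span_induction with
  | mem x hx =>
    obtain ⟨w, hw, rfl⟩ := hx
    refine hL.not_normal_induction (P := fun w => relationAt K L w F ∈ relationIdeal F)
      (fun j u h => ?_) (fun i v hv ih => ?_) w hw
    · simp only [relationAt_append hL j u h]
      exact TwoSidedIdeal.mul_mem_right _ _ _ (TwoSidedIdeal.subset_span ⟨j, rfl⟩)
    · simp only [relationAt_cons i hv]
      exact TwoSidedIdeal.mul_mem_left _ _ _ ih
  | zero => exact TwoSidedIdeal.zero_mem _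
  | add x y _ _ hx hy => exact TwoSidedIdeal.add_mem _ hx hy
  | smul c x _ hx =>
    rw [← one_mul x, ← smul_mul_assoc]
    exact TwoSidedIdeal.mul_mem_left _ _ _ hx

theorem mem_relationIdeal_iff (hL : SingleOverlap L z) {F : FreeAlg K n}
    (hcyc : F ∈ cyclicInvariants K n) (hF : normalSpan K L ⊔ relationSpan L F = ⊤)
    {a : FreeAlg K n} : a ∈ relationIdeal F ↔ a ∈ relationSpan L F := by
  refine ⟨fun ha => ?_, relationSpan_subset_relationIdeal hL⟩
  let I : TwoSidedIdeal (FreeAlg K n) :=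
    TwoSidedIdeal.mk' (relationSpan L F) (zero_mem _) add_mem neg_mem
      (mul_mem_relationSpan _) (fun h => relationSpan_mul_mem hL hcyc hF h _)
  have hI : relationIdeal F ≤ I := by
    refine TwoSidedIdeal.span_le.2 ?_
    rintro _ ⟨j, rfl⟩
    have := ncDeriv_mul_mem hL hcyc hF j 1
    rw [mul_one] at this
    simpa [I] using this
  simpa [I] using hI ha

/-- Normal words form a basis of the potential algebra and are stable under left multiplication
by `x_z`, so this multiplication is injective. -/
theorem PotentialAlgebra.gen_mul_ne_zero (hL : SingleOverlap L z) {F : FreeAlg K n}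
    (hcyc : F ∈ cyclicInvariants K n) (hli : LinearIndependent K (mixedFamily L F))
    (hspan : Submodule.span K (Set.range (mixedFamily L F)) = ⊤)
    {a : PotentialAlgebra F} (ha : a ≠ 0) : PotentialAlgebra.gen F z * a ≠ 0 := by
  have hF := normalSpan_sup_relationSpan hspan
  have hmk : ∀ b : FreeAlg K n, (relationIdeal F).ringCon.mk' b = 0 ↔ b ∈ relationSpan L F := by
    intro b
    rw [← mem_relationIdeal_iff hL hcyc hF, TwoSidedIdeal.mem_iff]
    exact RingCon.eq _
  obtain ⟨b, rfl⟩ := RingCon.mk'_surjective (relationIdeal F).ringCon a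
  rw [PotentialAlgebra.gen, ← map_mul]
  refine fun h => ha ((hmk b).2 ?_)
  rw [hmk] at h
  obtain ⟨c, hc, d, hd, rfl⟩ := Submodule.mem_sup.1 (hF ▸ Submodule.mem_top : b ∈ _)
  rw [mul_add] at h
  have h' := (Submodule.add_mem_iff_left _ (gen_mul_mem_relationSpan z hd)).1 h
  have h0 : _root_.gen K z * c = 0 :=
    Submodule.disjoint_def.1 (disjoint_normalSpan_relationSpan hli) _
    (gen_mul_mem_normalSpan hL hc) h'
  have hc0 : c = 0 := gen_mul_injective z (by simpa using h0)
  rw [hc0, zero_add]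
  exact hd

end Reduction

/-! ### Determinants and genericity -/

section Generic

variable {K : Type*} [Field K] {n : ℕ}

/-- Words of length `m`. -/
abbrev WordOfLength (n m : ℕ) : Type := {l : List (Fin n) // l.length = m}

instance (n m : ℕ) : Fintype (WordOfLength n m) := inferInstanceAs (Fintype (List.Vector (Fin n) m))

/-- The matrix of coefficients, in degree `m`, of a family of elements of the free algebra indexed
by words. -/
noncomputable def coeffMatrix (v : List (Fin n) → FreeAlg K n) (m : ℕ) :
    Matrix (WordOfLength n m) (WordOfLength n m) K :=
  Matrix.of fun w w' => coeffAt w'.1 (v w.1)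

section Graded

variable {v : List (Fin n) → FreeAlg K n}

theorem linearIndependent_of_det_ne_zero
    (hv : ∀ l l' : List (Fin n), l'.length ≠ l.length → coeffAt l' (v l) = 0)
    (hdet : ∀ m, (coeffMatrix v m).det ≠ 0) : LinearIndependent K v := by
  classical
  rw [linearIndependent_iff]
  intro c hc
  ext l
  have hzero : (fun w : WordOfLength n l.length => c w.1) = 0 := by
    refine Matrix.eq_zero_of_vecMul_eq_zero (hdet l.length) (funext fun w' => ?_)
    have h := congrArg (coeffAt w'.1) hc
    rw [Finsupp.linearCombination_apply, Finsupp.sum, map_sum, map_zero] at h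
    simp only [map_smul, smul_eq_mul] at h
    rw [Pi.zero_apply, ← h]
    change ∑ w : WordOfLength n l.length, c w.1 * coeffAt w'.1 (v w.1) = _
    refine Finset.sum_bij_ne_zero (fun w _ _ => w.1) (fun w _ hw => ?_)
      (fun _ _ _ _ _ _ => Subtype.ext) (fun w _ hw => ?_) (fun _ _ _ => rfl)
    · exact Finsupp.mem_support_iff.2 (left_ne_zero_of_mul hw)
    · refine ⟨⟨w, ?_⟩, Finset.mem_univ _, hw, rfl⟩
      by_contra hlen
      refine right_ne_zero_of_mul hw (hv _ _ ?_)
      rw [w'.2]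
      exact Ne.symm hlen
  exact congrFun hzero ⟨l, rfl⟩

theorem span_eq_top_of_det_ne_zero
    (hv : ∀ l l' : List (Fin n), l'.length ≠ l.length → coeffAt l' (v l) = 0)
    (hdet : ∀ m, (coeffMatrix v m).det ≠ 0) : Submodule.span K (Set.range v) = ⊤ := by
  classical
  rw [eq_top_iff, ← span_word, Submodule.span_le]
  rintro _ ⟨l, rfl⟩
  set A := coeffMatrix v l.length with hA
  have hinv : A⁻¹ * A = 1 := Matrix.nonsing_inv_mul A (isUnit_iff_ne_zero.2 (hdet _))
  have hword : word K l = ∑ w : WordOfLength n l.length, A⁻¹ ⟨l, rfl⟩ w • v w.1 := by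
    refine ext_coeffAt fun l' => ?_
    simp only [map_sum, map_smul, smul_eq_mul, coeffAt_word]
    by_cases hl : l'.length = l.length
    · have h := congrFun (congrFun hinv ⟨l, rfl⟩) ⟨l', hl⟩
      rw [Matrix.mul_apply, Matrix.one_apply] at h
      simpa [hA, coeffMatrix] using h.symm
    · rw [if_neg fun h => hl (by rw [h]), Finset.sum_eq_zero]
      intro w _
      rw [hv w.1 l' (by rwa [w.2]), mul_zero]
  rw [hword]
  exact sum_mem fun w _ => Submodule.smul_mem _ _ (Submodule.subset_span ⟨_, rfl⟩)

end Graded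

variable {L : Fin n → List (Fin n)} {z : Fin n} {k : ℕ}

theorem coeffAt_relationAt_of_length_ne (hL : SingleOverlap L z) (hk : ∀ j, (L j).length + 1 = k)
    {F : FreeAlg K n} (hF : F ∈ homogeneousPart K n k) (w : List (Fin n))
    (hw : ¬ IsNormalWord L w) :
    ∀ w' : List (Fin n), w'.length ≠ w.length → coeffAt w' (relationAt K L w F) = 0 := by
  refine hL.not_normal_induction (P := fun w => ∀ w' : List (Fin n), w'.length ≠ w.length →
    coeffAt w' (relationAt K L w F) = 0) (fun j u h w' hw' => ?_) (fun i v hv ih w' hw' => ?_) w hw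
  · rw [relationAt_append hL j u h]
    by_cases hex : ∃ t, t ++ u = w'
    · obtain ⟨t, rfl⟩ := hex
      rw [coeffAt_append_mul_word, coeffAt_ncDeriv]
      refine hF (FreeMonoid.ofList (j :: t)) fun hlen => hw' ?_
      have hlen' : t.length + 1 = k := hlen
      have := hk j
      simp only [List.length_append]
      omega
    · exact coeffAt_mul_word_eq_zero (fun t ht => hex ⟨t, ht⟩) _
  · rw [relationAt_cons i hv]
    cases w' with
    | nil => exact coeffAt_gen_mul_nil _ _
    | cons a s =>
      rw [coeffAt_gen_mul_cons]
      split_ifs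
      · exact ih s fun h => hw' (by simp [h])
      · rfl

theorem coeffAt_mixedFamily_of_length_ne (hL : SingleOverlap L z)
    (hk : ∀ j, (L j).length + 1 = k) {F : FreeAlg K n} (hF : F ∈ homogeneousPart K n k)
    (w w' : List (Fin n)) (h : w'.length ≠ w.length) : coeffAt w' (mixedFamily L F w) = 0 := by
  rw [mixedFamily]
  split_ifs with hw
  · rw [coeffAt_word, if_neg]
    rintro rfl
    exact h rfl
  · exact coeffAt_relationAt_of_length_ne hL hk hF w hw w' h

/-- `F` has leading words `L` (for the lexicographic order): the coefficient of `L j` in `δ_j F` is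
`1`, and every other word occurring in `δ_j F` is smaller than `L j`. -/
def HasLeadingWords (L : Fin n → List (Fin n)) (F : FreeAlg K n) : Prop :=
  ∀ j, coeffAt (L j) (ncDeriv j F) = 1 ∧
    ∀ t, t ≠ L j → coeffAt t (ncDeriv j F) ≠ 0 → t < L j

theorem append_lt_append_of_lt {α : Type*} [LinearOrder α] {s t : List α}
    (hlen : s.length = t.length) (h : s < t) (u : List α) : s ++ u < t ++ u := by
  induction s generalizing t with
  | nil =>
    rw [List.length_nil, eq_comm, List.length_eq_zero_iff] at hlen
    exact absurd h (by simp [hlen])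
  | cons a s ih =>
    cases t with
    | nil => simp at hlen
    | cons b t =>
      rw [List.cons_lt_cons_iff] at h
      rw [List.cons_append, List.cons_append, List.cons_lt_cons_iff]
      refine h.imp_right fun h => ⟨h.1, ih ?_ h.2⟩
      simpa using hlen

theorem coeffAt_relationAt_of_lt (hL : SingleOverlap L z) (hk : ∀ j, (L j).length + 1 = k)
    {F : FreeAlg K n} (hF : F ∈ homogeneousPart K n k) (hlead : HasLeadingWords L F)
    (w : List (Fin n)) (hw : ¬ IsNormalWord L w) :
    coeffAt w (relationAt K L w F) = 1 ∧
      ∀ w', w' ≠ w → coeffAt w' (relationAt K L w F) ≠ 0 → w' < w := by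
  refine hL.not_normal_induction (P := fun w => coeffAt w (relationAt K L w F) = 1 ∧
      ∀ w', w' ≠ w → coeffAt w' (relationAt K L w F) ≠ 0 → w' < w)
    (fun j u h => ?_) (fun i v hv ih => ?_) w hw
  · rw [relationAt_append hL j u h]
    refine ⟨(coeffAt_append_mul_word _ _ _).trans (hlead j).1, fun w' hne h0 => ?_⟩
    by_cases hex : ∃ t, t ++ u = w'
    · obtain ⟨t, rfl⟩ := hex
      rw [coeffAt_append_mul_word] at h0
      have hlen : t.length = (L j).length := by
        by_contra hlen
        refine h0 (hF (FreeMonoid.ofList (j :: t)) fun hlen' => hlen ?_)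
        have hlen'' : t.length + 1 = k := hlen'
        have := hk j
        omega
      exact append_lt_append_of_lt hlen ((hlead j).2 t (fun h => hne (by rw [h])) h0) u
    · exact absurd (coeffAt_mul_word_eq_zero (fun t ht => hex ⟨t, ht⟩) _) h0
  · rw [relationAt_cons i hv]
    refine ⟨by rw [coeffAt_gen_mul_cons, if_pos rfl, ih.1], fun w' hne h0 => ?_⟩
    cases w' with
    | nil => exact absurd (coeffAt_gen_mul_nil _ _) h0
    | cons a s =>
      rw [coeffAt_gen_mul_cons] at h0
      split_ifs at h0 with ha
      · subst ha
        rw [List.cons_lt_cons_iff]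
        exact .inr ⟨rfl, ih.2 s (fun h => hne (by rw [h])) h0⟩
      · exact absurd rfl h0

theorem det_coeffMatrix_mixedFamily (hL : SingleOverlap L z) (hk : ∀ j, (L j).length + 1 = k)
    {F : FreeAlg K n} (hF : F ∈ homogeneousPart K n k) (hlead : HasLeadingWords L F) (m : ℕ) :
    (coeffMatrix (mixedFamily L F) m).det = 1 := by
  rw [Matrix.det_of_isLowerTriangular]
  · refine Finset.prod_eq_one fun w _ => ?_
    change coeffAt w.1 (mixedFamily L F w.1) = 1
    rw [mixedFamily]
    split_ifs with hw
    · rw [coeffAt_word, if_pos rfl]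
    · exact (coeffAt_relationAt_of_lt hL hk hF hlead w.1 hw).1
  · intro w w' hlt
    have hlt' : w.1 < w'.1 := hlt
    change coeffAt w'.1 (mixedFamily L F w.1) = 0
    rw [mixedFamily]
    split_ifs with hw
    · rw [coeffAt_word, if_neg hlt'.ne]
    · by_contra h0
      exact lt_asymm hlt' ((coeffAt_relationAt_of_lt hL hk hF hlead w.1 hw).2 _ hlt'.ne' h0)

theorem isZariskiClosed_det_eq_zero (L : Fin n → List (Fin n)) (k m : ℕ) :
    IsZariskiClosed K {F : potentials K n k |
      (coeffMatrix (mixedFamily L (F : FreeAlg K n)) m).det = 0} := by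
  classical
  let A : Matrix (WordOfLength n m) (WordOfLength n m)
      (MvPolynomial (Module.Dual K (potentials K n k)) K) := Matrix.of fun w w' =>
    if IsNormalWord L w.1 then MvPolynomial.C (coeffAt w'.1 (word K w.1))
    else MvPolynomial.X ((coeffAt w'.1 ∘ₗ relationAt K L w.1) ∘ₗ (potentials K n k).subtype)
  refine ⟨{A.det}, ?_⟩
  ext F
  simp only [Set.mem_ofPred_eq, Set.mem_singleton_iff, forall_eq]
  rw [RingHom.map_det]
  have : (MvPolynomial.eval fun φ : Module.Dual K (potentials K n k) => φ F).mapMatrix A =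
      coeffMatrix (mixedFamily L (F : FreeAlg K n)) m := by
    ext w w'
    simp only [A, coeffMatrix, mixedFamily, RingHom.mapMatrix_apply, Matrix.map_apply,
      Matrix.of_apply]
    split_ifs with hw <;> simp
  rw [this]

/-- If some potential has leading words with a single overlap, then left multiplication by `x_z`
is injective on the generic potential algebra. -/
theorem holdsGenerically_of_hasLeadingWords (hL : SingleOverlap L z)
    (hk : ∀ j, (L j).length + 1 = k) {F₀ : FreeAlg K n} (hF₀ : F₀ ∈ potentials K n k)
    (hlead : HasLeadingWords L F₀) :
    HoldsGenerically K (V := potentials K n k) fun F =>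
      ∀ a : PotentialAlgebra (F : FreeAlg K n), a ≠ 0 →
        PotentialAlgebra.gen (F : FreeAlg K n) z * a ≠ 0 := by
  refine ⟨fun m => {F | (coeffMatrix (mixedFamily L (F : FreeAlg K n)) m).det = 0},
    fun m => ⟨isZariskiClosed_det_eq_zero L k m, fun h => ?_⟩, fun F hF a ha => ?_⟩
  · have h0 : (⟨F₀, hF₀⟩ : potentials K n k) ∈ Set.univ := Set.mem_univ _
    rw [← h, Set.mem_ofPred_eq, det_coeffMatrix_mixedFamily hL hk hF₀.2 hlead m] at h0
    exact one_ne_zero h0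
  · have hgr := coeffAt_mixedFamily_of_length_ne hL hk F.2.2
    exact PotentialAlgebra.gen_mul_ne_zero hL F.2.1
      (linearIndependent_of_det_ne_zero hgr hF) (span_eq_top_of_det_ne_zero hgr hF) ha

end Generic

/-! ### A potential with a single overlap of leading words -/

section Example

/-- A weakly decreasing word is lexicographically largest among its rearrangements. -/
theorem List.Perm.lt_of_sortedGE {α : Type*} [LinearOrder α] {s t : List α}
    (ht : t.Pairwise (· ≥ ·)) (h : s.Perm t) (hne : s ≠ t) : s < t := by
  induction t generalizing s with
  | nil => exact absurd h.eq_nil hne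
  | cons b t ih =>
    cases s with
    | nil => exact absurd h.symm.eq_nil (by simp)
    | cons a s =>
      rw [List.cons_lt_cons_iff]
      rw [List.pairwise_cons] at ht
      rcases List.mem_cons.1 (h.subset List.mem_cons_self) with rfl | ha
      · exact .inr ⟨rfl, ih ht.2 h.cons_inv fun h => hne (by rw [h])⟩
      · rcases (ht.1 a ha).lt_or_eq with hlt | rfl
        · exact .inl hlt
        · exact .inr ⟨rfl, ih ht.2 h.cons_inv fun h => hne (by rw [h])⟩

variable {n : ℕ}

/-- The leading words of the derivatives of `examplePotential`, for the degree `e + 3`. -/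
def exampleWords (x y z : Fin n) (e : ℕ) (j : Fin n) : List (Fin n) :=
  if j = x then y :: List.replicate (e + 1) z
  else if j = z then x :: y :: List.replicate e z
  else if j = y then x :: List.replicate (e + 1) z
  else x :: List.replicate (e + 1) j

/-- The words occurring in `examplePotential`: the rearrangements of `x y z ^ (e + 1)` and, for the
letters `w` other than `x`, `y`, `z`, those of `x w ^ (e + 2)`. -/
def exampleSupport (x y z : Fin n) (e : ℕ) : Set (List (Fin n)) :=
  {l | l.Perm (x :: y :: List.replicate (e + 1) z) ∨
    ∃ w, w ≠ x ∧ w ≠ y ∧ w ≠ z ∧ l.Perm (x :: List.replicate (e + 2) w)}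

open Classical in
/-- The sum of the words in `exampleSupport`. Being invariant under all permutations of positions,
it is a potential. -/
noncomputable def examplePotential (K : Type*) [Field K] (x y z : Fin n) (e : ℕ) : FreeAlg K n :=
  ∑ l : WordOfLength n (e + 3), if l.1 ∈ exampleSupport x y z e then word K l.1 else 0

variable {K : Type*} [Field K] {x y z : Fin n} {e : ℕ}

theorem length_of_mem_exampleSupport {l : List (Fin n)} (h : l ∈ exampleSupport x y z e) :
    l.length = e + 3 := by
  rcases h with h | ⟨w, -, -, -, h⟩ <;> simp [h.length_eq]

theorem mem_exampleSupport_of_perm {l l' : List (Fin n)} (hp : l.Perm l')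
    (h : l ∈ exampleSupport x y z e) : l' ∈ exampleSupport x y z e :=
  h.imp hp.symm.trans fun ⟨w, hx, hy, hz, h⟩ => ⟨w, hx, hy, hz, hp.symm.trans h⟩

open Classical in
theorem coeffAt_examplePotential (l : List (Fin n)) :
    coeffAt l (examplePotential K x y z e) = if l ∈ exampleSupport x y z e then 1 else 0 := by
  rw [examplePotential, map_sum]
  split_ifs with h
  · rw [Finset.sum_eq_single ⟨l, length_of_mem_exampleSupport h⟩]
    · rw [if_pos h, coeffAt_word, if_pos rfl]
    · intro w _ hw
      split_ifs
      · rw [coeffAt_word, if_neg fun h => hw (Subtype.ext h)]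
      · exact map_zero _
    · simp
  · refine Finset.sum_eq_zero fun w _ => ?_
    split_ifs with hw
    · rw [coeffAt_word, if_neg]
      rintro rfl
      exact h hw
    · exact map_zero _

theorem examplePotential_mem_potentials : examplePotential K x y z e ∈ potentials K n (e + 3) := by
  classical
  refine ⟨fun j u => ?_, fun w hw => ?_⟩
  · refine (coeffAt_examplePotential (j :: u.toList)).trans
      (Eq.trans ?_ (coeffAt_examplePotential (u.toList ++ [j])).symm)
    have hp : (j :: u.toList).Perm (u.toList ++ [j]) := (List.perm_append_singleton _ _).symm
    exact if_congr ⟨mem_exampleSupport_of_perm hp, mem_exampleSupport_of_perm hp.symm⟩ rfl rfl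
  · refine (coeffAt_examplePotential w.toList).trans (if_neg fun h => hw ?_)
    exact length_of_mem_exampleSupport h

theorem length_exampleWords (j : Fin n) : (exampleWords x y z e j).length = e + 2 := by
  rw [exampleWords]
  split_ifs <;> simp

theorem head_exampleWords {j a : Fin n} {s : List (Fin n)} (h : exampleWords x y z e j = a :: s) :
    a = x ∨ a = y := by
  rw [exampleWords] at h
  split_ifs at h <;> simp_all

/-- Prepending a power of a letter with which no leading word starts keeps a word normal. -/
theorem IsNormalWord.replicate_append {c : Fin n} (hx : c ≠ x) (hy : c ≠ y) (a : ℕ)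
    {u : List (Fin n)} (hu : IsNormalWord (exampleWords x y z e) u) :
    IsNormalWord (exampleWords x y z e) (List.replicate a c ++ u) := by
  induction a with
  | zero => exact hu
  | succ a ih =>
    intro j hj
    rw [List.replicate_succ, List.cons_append] at hj
    rcases List.infix_cons_iff.1 hj with ⟨t, ht⟩ | hj
    · rcases hLj : exampleWords x y z e j with _ | ⟨b, s⟩
      · have := length_exampleWords (x := x) (y := y) (z := z) (e := e) j
        simp [hLj] at this
      · rw [hLj] at ht
        obtain ⟨rfl, -⟩ := List.cons.inj ht
        rcases head_exampleWords hLj with h | h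
        · exact hx h
        · exact hy h
    · exact ih j hj

theorem exampleWords_injective (hzy : z ≠ y) (he : x = y → 1 ≤ e) :
    Function.Injective (exampleWords x y z e) := by
  intro i j h
  rcases e with _ | e
  · have hxy : x ≠ y := fun h => absurd (he h) (by simp)
    simp only [exampleWords] at h
    split_ifs at h <;> simp_all
  · simp only [exampleWords, List.replicate_succ] at h
    split_ifs at h <;> simp_all

theorem singleOverlap_exampleWords (hzy : z ≠ y) (hzx : z ≠ x) (he : x = y → 1 ≤ e) :
    SingleOverlap (exampleWords x y z e) z where
  ne_nil j h := by
    have := length_exampleWords (x := x) (y := y) (z := z) (e := e) j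
    simp [h] at this
  length_eq i j := by rw [length_exampleWords, length_exampleWords]
  injective := exampleWords_injective hzy he
  ne_cons j u h := (head_exampleWords h).elim hzx hzy
  overlap j u hu h := by
    rw [exampleWords] at h
    split_ifs at h with hjx hjz hjy
    · exact absurd (hu.replicate_append hzx hzy _) h
    · refine ⟨hjz, ?_⟩
      simp only [IsNormalWord, not_forall, not_not] at h
      obtain ⟨i, hi⟩ := h
      rw [List.tail_cons, List.cons_append] at hi
      rcases List.infix_cons_iff.1 hi with hi | hi
      · by_cases hix : i = x
        · rw [exampleWords, if_pos hix, List.cons_prefix_cons, List.replicate_succ',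
            List.prefix_append_right_inj] at hi
          obtain ⟨u', hu'⟩ := hi.2
          exact ⟨u', hu'.symm⟩
        · -- the word starts with `x`, so `x = y` and its second letter has to be `z`
          exfalso
          have hxy : x = y := by
            simp only [exampleWords, if_neg hix] at hi
            split_ifs at hi <;> exact (List.cons_prefix_cons.1 hi).1
          obtain ⟨e, rfl⟩ := Nat.exists_eq_add_of_le' (he hxy)
          rw [exampleWords, if_neg hix] at hi
          split_ifs at hi <;>
            simp_all [List.replicate_succ, List.cons_prefix_cons, eq_comm]
      · exact absurd hi (hu.replicate_append hzx hzy e i)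
    · exact absurd (hu.replicate_append hzx hzy _) h
    · exact absurd (hu.replicate_append hjx hjy _) h

theorem pairwise_ge_cons_replicate {a b : Fin n} (h : b ≤ a) (m : ℕ) :
    (a :: List.replicate m b).Pairwise (· ≥ ·) := by
  rw [List.pairwise_cons]
  exact ⟨fun c hc => (List.eq_of_mem_replicate hc).trans_le h,
    List.pairwise_replicate.2 (.inr le_rfl)⟩

theorem hasLeadingWords_examplePotential (hzy : z < y) (hyx : y ≤ x) (htop : ∀ w, w ≠ x → w ≤ y) :
    HasLeadingWords (exampleWords x y z e) (examplePotential K x y z e) := by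
  classical
  have hzx : z < x := hzy.trans_le hyx
  intro j
  simp only [coeffAt_ncDeriv, coeffAt_examplePotential]
  suffices h : j :: exampleWords x y z e j ∈ exampleSupport x y z e ∧
      ∀ t, t ≠ exampleWords x y z e j → j :: t ∈ exampleSupport x y z e →
        t < exampleWords x y z e j by
    refine ⟨if_pos h.1, fun t hne ht => h.2 t hne ?_⟩
    by_contra hmem
    exact ht (if_neg hmem)
  have hswap : ∀ a b : Fin n, ∀ l, (a :: b :: l).Perm (b :: a :: l) := fun a b l => .swap b a l
  have hyz := pairwise_ge_cons_replicate hzy.le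
  have hmem : ∀ {w a : Fin n} {m : ℕ}, a ≠ x → a ≠ w → ∀ {t : List (Fin n)},
      ¬ (a :: t).Perm (x :: List.replicate m w) := fun hx hw _ h => by
    rcases List.mem_cons.1 (h.subset List.mem_cons_self) with h | h
    · exact hx h
    · exact hw (List.eq_of_mem_replicate h)
  rw [exampleWords]
  split_ifs with hjx hjz hjy
  · subst hjx
    refine ⟨.inl .rfl, fun t hne ht => ?_⟩
    rcases ht with ht | ⟨w, hwx, hwy, -, ht⟩
    · exact ht.cons_inv.lt_of_sortedGE (hyz _) hne
    · rw [List.perm_replicate.1 ht.cons_inv, List.replicate_succ, List.cons_lt_cons_iff]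
      exact .inl ((htop w hwx).lt_of_ne hwy)
  · subst hjz
    have hp : (j :: x :: y :: List.replicate e j).Perm (x :: y :: List.replicate (e + 1) j) :=
      (hswap _ _ _).trans ((hswap _ _ _).cons _)
    refine ⟨.inl hp, fun t hne ht => ?_⟩
    rcases ht with ht | ⟨w, -, -, hwz, ht⟩
    · refine (ht.trans hp.symm).cons_inv.lt_of_sortedGE (List.pairwise_cons.2 ⟨?_, hyz e⟩) hne
      rintro c hc
      rcases List.mem_cons.1 hc with rfl | hc
      · exact hyx
      · exact (List.eq_of_mem_replicate hc).trans_le hzx.le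
    · exact absurd ht (hmem hzx.ne hwz.symm)
  · subst hjy
    refine ⟨.inl (hswap _ _ _), fun t hne ht => ?_⟩
    rcases ht with ht | ⟨w, -, hwy, -, ht⟩
    · exact (ht.trans (hswap _ _ _)).cons_inv.lt_of_sortedGE
        (pairwise_ge_cons_replicate hzx.le _) hne
    · exact absurd ht (hmem hjx hwy.symm)
  · refine ⟨.inr ⟨j, hjx, hjy, hjz, hswap _ _ _⟩, fun t hne ht => ?_⟩
    rcases ht with ht | ⟨w, hwx, -, -, ht⟩
    · have := ht.subset List.mem_cons_self
      simp only [List.mem_cons, hjx, hjy, false_or] at this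
      exact absurd (List.eq_of_mem_replicate this) hjz
    · obtain rfl : j = w := by
        by_contra hw
        exact hmem hjx hw ht
      exact (ht.trans (hswap j x (List.replicate (e + 1) j)).symm).cons_inv.lt_of_sortedGE
        (pairwise_ge_cons_replicate ((htop j hjx).trans hyx) _) hne

end Example

/-! ### Injectivity of multiplication by the first letter -/

theorem lemma2p3 (K : Type*) [Field K] [Uncountable K] (n k : ℕ) (hn : 2 ≤ n) (hk : 3 ≤ k)
    (hnk : (n, k) ≠ (2, 3)) :
    HoldsGenerically K (V := potentials K n k) fun F =>
      ∀ a : PotentialAlgebra (F : FreeAlg K n), a ≠ 0 →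
        PotentialAlgebra.gen (F : FreeAlg K n) ⟨0, by omega⟩ * a ≠ 0 := by
  obtain ⟨e, rfl⟩ := Nat.exists_eq_add_of_le' hk
  -- for `n = 2` the letters `x` and `y` coincide, and then `e ≥ 1`
  let x : Fin n := ⟨n - 1, by omega⟩
  let y : Fin n := ⟨max (n - 2) 1, by omega⟩
  let z : Fin n := ⟨0, by omega⟩
  have hzy : z < y := Fin.mk_lt_mk.2 (by omega)
  have hyx : y ≤ x := Fin.mk_le_mk.2 (by omega)
  have htop : ∀ w : Fin n, w ≠ x → w ≤ y := by
    intro w hw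
    have hw' : w.1 ≠ n - 1 := fun h => hw (Fin.ext h)
    exact Fin.le_def.2 (by change w.1 ≤ max (n - 2) 1; omega)
  have he : x = y → 1 ≤ e := by
    intro h
    have h' : n - 1 = max (n - 2) 1 := congrArg Fin.val h
    by_contra hlt
    exact hnk (by rw [Prod.mk.injEq]; omega)
  exact holdsGenerically_of_hasLeadingWords
    (singleOverlap_exampleWords hzy.ne (hzy.trans_le hyx).ne he)
    (fun j => by rw [length_exampleWords]) examplePotential_mem_potentials
    (hasLeadingWords_examplePotential hzy hyx htop)
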